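/- Let $N\ge 1$. On $\mathbb R^{2N}$ with coordinates $(q_1,\dots,q_N,p_1,\dots,p_N)$ let $J_0$ be the standard symplectic bracket, $\{q_i,p_i\}=1$, and let $J_1$ be the bracket $\{q_i,q_j\}=1$ for $i<j$, $\{p_i,q_i\}=p_i$, $\{p_i,p_{i+1}\}=e^{q_i-q_{i+1}}$ (all other brackets of coordinates, apart from those given by antisymmetry, are zero). Put $\mathcal R=J_1J_0^{-1}$ and $J_k=\mathcal R^kJ_0$ for $k\ge 0$. Let $F:\mathbb R^{2N}\to\mathbb R^{2N-1}$, $F(q,p)=(a_1,\dots,a_{N-1},b_1,\dots,b_N)$, be Flaschka's transformation $$a_i=\tfrac12 e^{\frac12(q_i-q_{i+1})},\qquad b_i=-\tfrac12 p_i .$$ For $n\ge 1$ the $n$-th Toda bracket $\pi_n$ is the contravariant antisymmetric 2-tensor field on $\mathbb R^{2N-1}$, polynomial in $(a,b)$, to which $\frac{4}{2^{\,n-1}}J_{n-1}$ is mapped by $F$. In particular, $\pi_1$ is the linear bracket $\{a_i,b_i\}=-a_i$, $\{a_i,b_{i+1}\}=a_i$, and $\pi_2$ is the quadratic bracket $\{a_i,a_{i+1}\}=\frac12a_ia_{i+1}$,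 $\{a_i,b_i\}=-a_ib_i$, $\{a_i,b_{i+1}\}=a_ib_{i+1}$, $\{b_i,b_{i+1}\}=2a_i^2$. Then for every $n\ge1$ the shift $$f(a_1,\dots,a_{N-1},b_1,\dots,b_N)=(a_1,\dots,a_{N-1},1+b_1,\dots,1+b_N)$$ is an isomorphism between the $n$-th Toda bracket and the binomial combination of the first $n$ of them: $$\pi_n\;\cong\;\sum_{j=0}^{n-1}\binom{n-1}{j}\,\pi_{n-j}.$$ That is, $f$ is a smooth diffeomorphism of $\mathbb R^{2N-1}$, and $\{g\circ f,h\circ f\}'=\{g,h\}_n\circ f$ for all smooth functions $g,h$ on $\mathbb R^{2N-1}$, where $\{\cdot,\cdot\}_n$ is the bracket of $\pi_n$ and $\{\cdot,\cdot\}'$ is the bracket of $\sum_{j=0}^{n-1}\binom{n-1}{j}\pi_{n-j}$. For $n=2$ this is the isomorphism $\pi_2\cong\pi_1+\pi_2$. -/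

import Mathlib

namespace TodaLattice

open scoped ContDiff

/-! ## Brackets defined by contravariant 2-tensor fields on a coordinate space -/

/-- The bracket `{f, g} = ∑ π^{ij} ∂f/∂x_i ∂g/∂x_j` of a contravariant 2-tensor field `π`, given by
its matrix of coefficients `π^{ij} = {x_i, x_j}`. -/
noncomputable def bracket {ι : Type} [Fintype ι] [DecidableEq ι]
    (π : (ι → ℝ) → Matrix ι ι ℝ) (f g : (ι → ℝ) → ℝ) (x : ι → ℝ) : ℝ :=
  ∑ i, ∑ j, π x i j * fderiv ℝ f x (Pi.single i 1) * fderiv ℝ g x (Pi.single j 1)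

/-- `Φ` is an isomorphism from `π₁` to `π₂`: a smooth diffeomorphism which is a Poisson mapping,
`{f ∘ Φ, g ∘ Φ}₁ = {f, g}₂ ∘ Φ` for all smooth `f`, `g`. -/
structure IsPoissonIso {ι : Type} [Fintype ι] [DecidableEq ι]
    (π₁ π₂ : (ι → ℝ) → Matrix ι ι ℝ) (Φ : (ι → ℝ) → (ι → ℝ)) : Prop where
  contDiff : ContDiff ℝ ∞ Φ
  exists_inverse : ∃ Ψ : (ι → ℝ) → (ι → ℝ),
    ContDiff ℝ ∞ Ψ ∧ Function.LeftInverse Ψ Φ ∧ Function.RightInverse Ψ Φ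
  map_bracket : ∀ f g : (ι → ℝ) → ℝ, ContDiff ℝ ∞ f → ContDiff ℝ ∞ g →
    ∀ x, bracket π₁ (f ∘ Φ) (g ∘ Φ) x = bracket π₂ f g (Φ x)

/-! ## The hierarchy in canonical coordinates

There are `N = m + 1` particles. Indices are zero-based: `i : Fin m` stands for a pair of
neighbours `(i.castSucc, i.succ)`. -/

/-- The space `ℝ^{2N}` with coordinates `q_i` (at `inl i`) and `p_i` (at `inr i`). -/
abbrev PhaseSpace (m : ℕ) : Type := Fin (m + 1) ⊕ Fin (m + 1) → ℝ

/-- The space `ℝ^{2N-1}` with coordinates `a_i` (at `inl i`) and `b_i` (at `inr i`). -/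
abbrev FlaschkaSpace (m : ℕ) : Type := Fin m ⊕ Fin (m + 1) → ℝ

/-- The matrix of the standard symplectic bracket `J₀`: `{q_i, p_i} = 1`. -/
def symplecticMatrix (m : ℕ) :
    Matrix (Fin (m + 1) ⊕ Fin (m + 1)) (Fin (m + 1) ⊕ Fin (m + 1)) ℝ :=
  Matrix.fromBlocks 0 1 (-1) 0

/-- The matrix of the second bracket `J₁`: `{q_i, q_j} = 1` for `i < j`, `{p_i, q_i} = p_i`,
`{p_i, p_{i+1}} = w_i`, where `w_i` is the value of `exp (q_i - q_{i+1})`. -/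
def secondMatrix {m : ℕ} (w : Fin m → ℝ) (p : Fin (m + 1) → ℝ) :
    Matrix (Fin (m + 1) ⊕ Fin (m + 1)) (Fin (m + 1) ⊕ Fin (m + 1)) ℝ :=
  Matrix.fromBlocks
    (Matrix.of fun i j => if i < j then 1 else if j < i then -1 else 0)
    (-Matrix.diagonal p)
    (Matrix.diagonal p)
    (Matrix.of fun i j => ∑ k : Fin m,
      ((if i = k.castSucc ∧ j = k.succ then w k else 0) -
        (if i = k.succ ∧ j = k.castSucc then w k else 0)))

/-- The recursion operator `R = J₁ J₀⁻¹`. -/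
noncomputable def recursionMatrix {m : ℕ} (w : Fin m → ℝ) (p : Fin (m + 1) → ℝ) :
    Matrix (Fin (m + 1) ⊕ Fin (m + 1)) (Fin (m + 1) ⊕ Fin (m + 1)) ℝ :=
  secondMatrix w p * (symplecticMatrix m)⁻¹

/-- The higher order tensors `J_k = R^k J₀`. -/
noncomputable def hierarchyMatrix {m : ℕ} (k : ℕ) (w : Fin m → ℝ) (p : Fin (m + 1) → ℝ) :
    Matrix (Fin (m + 1) ⊕ Fin (m + 1)) (Fin (m + 1) ⊕ Fin (m + 1)) ℝ :=
  recursionMatrix w p ^ k * symplecticMatrix m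

/-- The tensor field `J_k` on the phase space. -/
noncomputable def canonicalTensor (m k : ℕ) (x : PhaseSpace m) :
    Matrix (Fin (m + 1) ⊕ Fin (m + 1)) (Fin (m + 1) ⊕ Fin (m + 1)) ℝ :=
  hierarchyMatrix k (fun i : Fin m => Real.exp (x (Sum.inl i.castSucc) - x (Sum.inl i.succ)))
    (fun i => x (Sum.inr i))

/-! ## Reduction to the Flaschka variables -/

/-- Flaschka's transformation `a_i = ½ exp (½ (q_i - q_{i+1}))`, `b_i = -½ p_i`. -/
noncomputable def flaschka (m : ℕ) (x : PhaseSpace m) : FlaschkaSpace m :=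
  Sum.elim
    (fun i => 1 / 2 * Real.exp (1 / 2 * (x (Sum.inl i.castSucc) - x (Sum.inl i.succ))))
    (fun i => -(1 / 2) * x (Sum.inr i))

/-- The Jacobian matrix of Flaschka's transformation, as a function of `a`. -/
noncomputable def flaschkaJacobian {m : ℕ} (a : Fin m → ℝ) :
    Matrix (Fin m ⊕ Fin (m + 1)) (Fin (m + 1) ⊕ Fin (m + 1)) ℝ :=
  Matrix.fromBlocks
    (Matrix.of fun i j =>
      (if j = i.castSucc then a i / 2 else 0) - (if j = i.succ then a i / 2 else 0))
    0 0 (-((1 / 2 : ℝ) • 1))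

/-- The `n`-th Toda tensor `π_n` (`n ≥ 1`) on `ℝ^{2N-1}`: the tensor `J_{n-1}` pushed forward by
Flaschka's transformation, i.e. with `exp (q_i - q_{i+1}) = 4 a_i²` and `p_i = -2 b_i`, and extended
to all `(a, b)` by the same polynomial formula. The factor `4 / 2^(n-1)` is the normalization for
which `{a_i, b_i}₁ = -a_i` and `{a_i, b_i}₂ = -a_i b_i`. -/
noncomputable def todaTensor (m n : ℕ) (x : FlaschkaSpace m) :
    Matrix (Fin m ⊕ Fin (m + 1)) (Fin m ⊕ Fin (m + 1)) ℝ :=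
  (4 / 2 ^ (n - 1) : ℝ) •
    (flaschkaJacobian (fun i => x (Sum.inl i)) *
      hierarchyMatrix (n - 1) (fun i : Fin m => 4 * x (Sum.inl i) ^ 2)
        (fun i => -2 * x (Sum.inr i)) *
      (flaschkaJacobian (fun i => x (Sum.inl i))).transpose)

/-- The map `(a, b) ↦ (a_1, …, a_{N-1}, 1 + b_1, …, 1 + b_N)`. -/
def shift (m : ℕ) (x : FlaschkaSpace m) : FlaschkaSpace m :=
  Sum.elim (fun i => x (Sum.inl i)) (fun i => 1 + x (Sum.inr i))

/-! ## `todaTensor` is the reduction of the canonical hierarchy -/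

/-- The Jacobian matrix is the derivative of Flaschka's transformation. -/
theorem hasFDerivAt_flaschka (m : ℕ) (x : PhaseSpace m) :
    HasFDerivAt (flaschka m)
      (LinearMap.toContinuousLinearMap
        (flaschkaJacobian (fun i => flaschka m x (Sum.inl i))).mulVecLin) x := by
  rw [hasFDerivAt_pi']
  rintro (i | i)
  · have h1 : HasFDerivAt (fun y : PhaseSpace m => y (Sum.inl i.castSucc))
        (ContinuousLinearMap.proj (Sum.inl i.castSucc) : PhaseSpace m →L[ℝ] ℝ) x :=
      hasFDerivAt_apply _ _
    have h2 : HasFDerivAt (fun y : PhaseSpace m => y (Sum.inl i.succ))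
        (ContinuousLinearMap.proj (Sum.inl i.succ) : PhaseSpace m →L[ℝ] ℝ) x :=
      hasFDerivAt_apply _ _
    have h := (((h1.sub h2).const_mul (1 / 2 : ℝ)).exp).const_mul (1 / 2 : ℝ)
    refine h.congr_fderiv ?_
    refine ContinuousLinearMap.ext fun v => ?_
    simp [flaschka, flaschkaJacobian, Matrix.mulVec, dotProduct, sub_mul]
    ring
  · have h1 : HasFDerivAt (fun y : PhaseSpace m => y (Sum.inr i))
        (ContinuousLinearMap.proj (Sum.inr i) : PhaseSpace m →L[ℝ] ℝ) x :=
      hasFDerivAt_apply _ _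
    refine (h1.const_mul (-(1 / 2) : ℝ)).congr_fderiv ?_
    refine ContinuousLinearMap.ext fun v => ?_
    simp [flaschkaJacobian, Matrix.mulVec, dotProduct, Matrix.one_apply]

theorem bracket_eq_dotProduct {ι : Type} [Fintype ι] [DecidableEq ι]
    (π : (ι → ℝ) → Matrix ι ι ℝ) (f g : (ι → ℝ) → ℝ) (x : ι → ℝ) :
    bracket π f g x = (fun i => fderiv ℝ f x (Pi.single i 1)) ⬝ᵥ
      (π x).mulVec (fun i => fderiv ℝ g x (Pi.single i 1)) := by
  simp only [bracket, dotProduct, Matrix.mulVec, Finset.mul_sum]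
  refine Finset.sum_congr rfl fun i _ => Finset.sum_congr rfl fun j _ => ?_
  ring

theorem fderiv_comp_flaschka (m : ℕ) (f : FlaschkaSpace m → ℝ) (x : PhaseSpace m)
    (hf : DifferentiableAt ℝ f (flaschka m x)) :
    (fun i => fderiv ℝ (f ∘ flaschka m) x (Pi.single i 1)) =
      (flaschkaJacobian (fun i => flaschka m x (Sum.inl i))).transpose.mulVec
        (fun i => fderiv ℝ f (flaschka m x) (Pi.single i 1)) := by
  funext i
  rw [(hf.hasFDerivAt.comp x (hasFDerivAt_flaschka m x)).fderiv]
  rw [ContinuousLinearMap.comp_apply, LinearMap.coe_toContinuousLinearMap',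
    Matrix.mulVecLin_apply, Matrix.mulVec_single_one]
  conv_lhs => rw [pi_eq_sum_univ' (Matrix.col _ i)]
  rw [map_sum]
  refine Finset.sum_congr rfl fun j _ => ?_
  rw [map_smul, smul_eq_mul]
  congr 2

/-- Flaschka's transformation maps the canonical tensor `J_k`, up to normalization, to the Toda
tensor `π_{k+1}`. -/
theorem bracket_todaTensor_flaschka (m k : ℕ) (f g : FlaschkaSpace m → ℝ) (x : PhaseSpace m)
    (hf : DifferentiableAt ℝ f (flaschka m x)) (hg : DifferentiableAt ℝ g (flaschka m x)) :
    bracket (todaTensor m (k + 1)) f g (flaschka m x) =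
      4 / 2 ^ k * bracket (canonicalTensor m k) (f ∘ flaschka m) (g ∘ flaschka m) x := by
  have hc : hierarchyMatrix k (fun i : Fin m => 4 * flaschka m x (Sum.inl i) ^ 2)
      (fun i => -2 * flaschka m x (Sum.inr i)) = canonicalTensor m k x := by
    unfold canonicalTensor
    congr 1
    · funext i
      simp only [flaschka, Sum.elim_inl, mul_pow, ← Real.exp_nat_mul]
      push_cast
      ring_nf
    · funext i
      simp only [flaschka, Sum.elim_inr]
      ring
  rw [bracket_eq_dotProduct, bracket_eq_dotProduct, fderiv_comp_flaschka m f x hf,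
    fderiv_comp_flaschka m g x hg]
  simp only [todaTensor, Nat.add_sub_cancel]
  rw [hc, Matrix.smul_mulVec, dotProduct_smul, smul_eq_mul]
  congr 1
  rw [← Matrix.mulVec_mulVec, ← Matrix.mulVec_mulVec, Matrix.dotProduct_mulVec,
    Matrix.mulVec_transpose, Matrix.mulVec_transpose]

/-! ## The first two tensors of the hierarchy -/

theorem symplecticMatrix_inv_mul (m : ℕ) :
    (symplecticMatrix m)⁻¹ * symplecticMatrix m = 1 := by
  have h : (-symplecticMatrix m) * symplecticMatrix m = 1 := by
    simp [symplecticMatrix, Matrix.fromBlocks_multiply, Matrix.fromBlocks_neg]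
  rw [Matrix.inv_eq_left_inv h, h]

/-- The linear bracket: `{a_i, b_i} = -a_i`, `{a_i, b_{i+1}} = a_i`, all others zero. -/
theorem todaTensor_one (m : ℕ) (x : FlaschkaSpace m) :
    todaTensor m 1 x =
      Matrix.fromBlocks 0
        (Matrix.of fun i j => (if j = i.succ then x (Sum.inl i) else 0) -
          (if j = i.castSucc then x (Sum.inl i) else 0))
        (Matrix.of fun j i => (if j = i.castSucc then x (Sum.inl i) else 0) -
          (if j = i.succ then x (Sum.inl i) else 0))
        0 := by
  simp only [todaTensor, hierarchyMatrix, symplecticMatrix, flaschkaJacobian, Nat.sub_self,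
    pow_zero, Matrix.one_mul, Matrix.fromBlocks_multiply, Matrix.fromBlocks_transpose,
    Matrix.fromBlocks_smul]
  congr 1
  · simp
  · ext i j
    simp
    split_ifs <;> ring
  · ext i j
    simp
    split_ifs <;> ring
  · simp

theorem sum_ite_sub_ite_mul {ι : Type} [Fintype ι] [DecidableEq ι] (u v : ι) (c : ℝ)
    (F : ι → ℝ) :
    ∑ k, ((if k = u then c else 0) - (if k = v then c else 0)) * F k = c * (F u - F v) := by
  simp [sub_mul, mul_sub]

theorem sum_mul_ite_sub_ite {ι : Type} [Fintype ι] [DecidableEq ι] (u v : ι) (c : ℝ)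
    (F : ι → ℝ) :
    ∑ k, F k * ((if k = u then c else 0) - (if k = v then c else 0)) = c * (F u - F v) := by
  simp only [mul_comm (F _), sum_ite_sub_ite_mul]

/-- The quadratic bracket: `{a_i, a_{i+1}} = ½ a_i a_{i+1}`, `{a_i, b_i} = -a_i b_i`,
`{a_i, b_{i+1}} = a_i b_{i+1}`, `{b_i, b_{i+1}} = 2 a_i²`, all others zero. -/
theorem todaTensor_two (m : ℕ) (x : FlaschkaSpace m) :
    todaTensor m 2 x =
      Matrix.fromBlocks
        (Matrix.of fun (i j : Fin m) =>
          (if j.val = i.val + 1 then 1 / 2 * x (Sum.inl i) * x (Sum.inl j) else 0) -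
          (if i.val = j.val + 1 then 1 / 2 * x (Sum.inl i) * x (Sum.inl j) else 0))
        (Matrix.of fun i j => (if j = i.succ then x (Sum.inl i) * x (Sum.inr j) else 0) -
          (if j = i.castSucc then x (Sum.inl i) * x (Sum.inr j) else 0))
        (Matrix.of fun j i => (if j = i.castSucc then x (Sum.inl i) * x (Sum.inr j) else 0) -
          (if j = i.succ then x (Sum.inl i) * x (Sum.inr j) else 0))
        (Matrix.of fun i j => ∑ k : Fin m,
          ((if i = k.castSucc ∧ j = k.succ then 2 * x (Sum.inl k) ^ 2 else 0) -
            (if i = k.succ ∧ j = k.castSucc then 2 * x (Sum.inl k) ^ 2 else 0))) := by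
  simp only [todaTensor, hierarchyMatrix, recursionMatrix, Nat.add_one_sub_one, pow_one,
    Matrix.mul_assoc, symplecticMatrix_inv_mul, Matrix.mul_one]
  simp only [secondMatrix, flaschkaJacobian,
    Matrix.fromBlocks_multiply, Matrix.fromBlocks_transpose, Matrix.fromBlocks_smul]
  congr 1
  · ext i j
    simp only [Matrix.transpose_zero, Matrix.mul_zero, Matrix.zero_mul, add_zero,
      Matrix.smul_apply, smul_eq_mul, Matrix.mul_apply, Matrix.transpose_apply, Matrix.of_apply,
      sum_ite_sub_ite_mul, sum_mul_ite_sub_ite, Fin.lt_def, Fin.val_castSucc, Fin.val_succ]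
    split_ifs <;> first | omega | ring
  · ext i j
    simp only [Matrix.transpose_neg, Matrix.transpose_smul, Matrix.transpose_one,
      Matrix.transpose_zero, Matrix.mul_neg, Matrix.mul_smul, Matrix.mul_one, Matrix.mul_zero,
      Matrix.zero_mul, add_zero, zero_add, smul_zero, neg_zero, Matrix.smul_apply,
      smul_eq_mul, Matrix.mul_diagonal, Matrix.neg_apply, Matrix.of_apply]
    split_ifs <;> ring
  · ext i j
    simp only [Matrix.transpose_zero, Matrix.mul_zero, Matrix.zero_mul, add_zero, zero_add,
      Matrix.neg_mul, Matrix.smul_mul, Matrix.one_mul, Matrix.smul_apply, Matrix.neg_apply,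
      smul_eq_mul, Matrix.mul_apply, Matrix.transpose_apply, Matrix.of_apply,
      sum_mul_ite_sub_ite, Matrix.diagonal_apply]
    split_ifs <;> ring
  · ext i j
    simp only [Matrix.transpose_neg, Matrix.transpose_smul, Matrix.transpose_one,
      Matrix.transpose_zero, Matrix.mul_neg, Matrix.neg_mul, Matrix.mul_smul, Matrix.mul_one,
      Matrix.smul_mul, Matrix.one_mul, Matrix.mul_zero, Matrix.zero_mul, zero_add, neg_neg,
      smul_neg, smul_zero, Matrix.smul_apply, smul_eq_mul, Matrix.of_apply, Finset.mul_sum]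
    refine Finset.sum_congr rfl fun k _ => ?_
    split_ifs <;> ring

/-- The Toda tensors are antisymmetric. -/
theorem transpose_todaTensor (m n : ℕ) (x : FlaschkaSpace m) :
    (todaTensor m n x).transpose = -todaTensor m n x := by
  have h0 : (symplecticMatrix m).transpose = -symplecticMatrix m := by
    simp [symplecticMatrix, Matrix.fromBlocks_transpose, Matrix.fromBlocks_neg]
  have h1 : ∀ (w : Fin m → ℝ) (p : Fin (m + 1) → ℝ),
      (secondMatrix w p).transpose = -secondMatrix w p := by
    intro w p
    rw [secondMatrix, Matrix.fromBlocks_transpose, Matrix.fromBlocks_neg]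
    congr 1
    · ext i j
      simp only [Matrix.transpose_apply, Matrix.of_apply, Matrix.neg_apply]
      split_ifs <;> first | omega | simp
    · simp
    · simp
    · ext i j
      simp only [Matrix.transpose_apply, Matrix.of_apply, Matrix.neg_apply,
        ← Finset.sum_neg_distrib, neg_sub]
      refine Finset.sum_congr rfl fun k _ => ?_
      simp only [and_comm]
  have hi : symplecticMatrix m * (symplecticMatrix m)⁻¹ = 1 :=
    mul_eq_one_comm.mp (symplecticMatrix_inv_mul m)
  have h2 : ∀ (k : ℕ) (w : Fin m → ℝ) (p : Fin (m + 1) → ℝ),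
      (hierarchyMatrix k w p).transpose = -hierarchyMatrix k w p := by
    intro k w p
    have hs : SemiconjBy (symplecticMatrix m) ((symplecticMatrix m)⁻¹ * secondMatrix w p)
        (recursionMatrix w p) := by
      rw [SemiconjBy, recursionMatrix, ← Matrix.mul_assoc, hi, Matrix.mul_assoc,
        symplecticMatrix_inv_mul, Matrix.one_mul, Matrix.mul_one]
    have ht : (recursionMatrix w p).transpose = (symplecticMatrix m)⁻¹ * secondMatrix w p := by
      have hn : (-symplecticMatrix m)⁻¹ = -(symplecticMatrix m)⁻¹ :=
        Matrix.inv_eq_left_inv (by rw [neg_mul_neg, symplecticMatrix_inv_mul])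
      rw [recursionMatrix, Matrix.transpose_mul, h1, Matrix.transpose_nonsing_inv, h0, hn,
        neg_mul_neg]
    rw [hierarchyMatrix, Matrix.transpose_mul, Matrix.transpose_pow, ht, h0, neg_mul,
      (hs.pow_right k).eq]
  rw [todaTensor, Matrix.transpose_smul, Matrix.transpose_mul, Matrix.transpose_mul,
    Matrix.transpose_transpose, h2, Matrix.neg_mul, Matrix.mul_neg,
    smul_neg, Matrix.mul_assoc]

end TodaLattice

namespace TodaLattice

/-! Since `p = -2b`, adding 1 to every `b_i` adds `c = -2` to every `p_i`. The tensor `J₁` is affine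
in `p`, and its `p`-linear part responds to a common translation by `-c J₀`
(`secondMatrix_add_const`). Hence `R = J₁ J₀⁻¹` becomes `R - c = R + 2`, and the binomial theorem
expands `(R + 2)^k J₀` as the sum of `(k choose j) 2^j J_{k-j}` (`hierarchyMatrix_add_const`). The
normalization `4 / 2^k` absorbs the `2^j`, and the Jacobian of Flaschka's map involves only `a`, so
the expansion descends to the Toda tensors (`todaTensor_shift`). A translation has identity
derivative, so this identity of coefficient matrices is already the Poisson property. -/

/-- Translating all momenta by `c` changes the second bracket by a multiple of the first. -/
theorem secondMatrix_add_const {m : ℕ} (w : Fin m → ℝ) (p : Fin (m + 1) → ℝ) (c : ℝ) :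
    secondMatrix w (fun i => p i + c) = secondMatrix w p - c • symplecticMatrix m := by
  have hd : Matrix.diagonal (fun i => p i + c) = Matrix.diagonal p + c • 1 := by
    rw [Matrix.smul_one_eq_diagonal, Matrix.diagonal_add]
  simp only [secondMatrix, symplecticMatrix, hd, sub_eq_add_neg, Matrix.fromBlocks_smul,
    Matrix.fromBlocks_neg, Matrix.fromBlocks_add, smul_zero, neg_zero, add_zero, smul_neg,
    neg_neg, neg_add]

/-- Multiplying by `J₀⁻¹` turns the `J₀` correction into a scalar matrix, which commutes with
everything. -/
theorem recursionMatrix_add_const {m : ℕ} (w : Fin m → ℝ) (p : Fin (m + 1) → ℝ) (c : ℝ) :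
    recursionMatrix w (fun i => p i + c) = recursionMatrix w p - c • 1 := by
  rw [recursionMatrix, secondMatrix_add_const, sub_mul, Matrix.smul_mul,
    mul_eq_one_comm.mp (symplecticMatrix_inv_mul m), recursionMatrix]

theorem hierarchyMatrix_add_const {m : ℕ} (k : ℕ) (w : Fin m → ℝ) (p : Fin (m + 1) → ℝ)
    (c : ℝ) :
    hierarchyMatrix k w (fun i => p i + c) =
      ∑ j ∈ Finset.range (k + 1), ((-c) ^ j * (k.choose j : ℝ)) • hierarchyMatrix (k - j) w p := by
  have hc : Commute ((-c) • (1 : Matrix (Fin (m + 1) ⊕ Fin (m + 1)) (Fin (m + 1) ⊕ Fin (m + 1)) ℝ))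
      (recursionMatrix w p) := (Commute.one_left _).smul_left _
  -- The scalar is moved to the left so that `add_pow` gives it the exponent `j` and leaves `R` the
  -- exponent `k - j`.
  rw [hierarchyMatrix, recursionMatrix_add_const, sub_eq_neg_add, ← neg_smul, hc.add_pow,
    Finset.sum_mul]
  refine Finset.sum_congr rfl fun j _ => ?_
  rw [hierarchyMatrix, smul_pow, one_pow, Matrix.smul_mul, one_mul, Matrix.smul_mul,
    Matrix.smul_mul, mul_smul, ← nsmul_eq_mul', Nat.cast_smul_eq_nsmul, Matrix.smul_mul]

/-- The shift fixes `a`, hence also the Jacobian and the weights `4 a_i²`; only the momenta move, so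
the binomial expansion applies with `c = -2`. -/
theorem todaTensor_shift (m k : ℕ) (x : FlaschkaSpace m) :
    todaTensor m (k + 1) (shift m x) =
      ∑ j ∈ Finset.range (k + 1), (k.choose j : ℝ) • todaTensor m (k + 1 - j) x := by
  have hp : (fun i : Fin (m + 1) => -2 * shift m x (Sum.inr i)) =
      fun i => -2 * x (Sum.inr i) + -2 := by
    funext i
    simp only [shift, Sum.elim_inr]
    ring
  have ha : ∀ i : Fin m, shift m x (Sum.inl i) = x (Sum.inl i) := fun _ => rfl
  simp only [todaTensor, ha, Nat.add_sub_cancel]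
  rw [hp, hierarchyMatrix_add_const]
  simp only [Matrix.mul_sum, Matrix.sum_mul, Finset.smul_sum, Matrix.mul_smul, Matrix.smul_mul,
    smul_smul]
  refine Finset.sum_congr rfl fun j hj => ?_
  have hjk : j ≤ k := Nat.lt_succ_iff.mp (Finset.mem_range.mp hj)
  rw [show k + 1 - j - 1 = k - j by omega]
  congr 1
  -- The bound `j ≤ k` makes the subtraction genuine, and then `4 / 2^k * 2^j = 4 / 2^(k-j)` is
  -- exactly the normalization of `π_{k+1-j}`.
  have h2 : (2 : ℝ) ^ k = 2 ^ (k - j) * 2 ^ j := by rw [← pow_add, Nat.sub_add_cancel hjk]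
  rw [h2, neg_neg]
  field_simp

theorem shift_eq_add (m : ℕ) : shift m = fun x => x + (Sum.elim (fun _ => 0) fun _ => 1 : FlaschkaSpace m) := by
  funext x i
  rcases i with i | i
  · simp [shift]
  · simp [shift, add_comm]

/-- A translation is a Poisson isomorphism as soon as it carries one tensor to the other. -/
theorem isPoissonIso_add_const {ι : Type} [Fintype ι] [DecidableEq ι]
    (π₁ π₂ : (ι → ℝ) → Matrix ι ι ℝ) (c : ι → ℝ) (h : ∀ x, π₁ x = π₂ (x + c)) :
    IsPoissonIso π₁ π₂ (fun x => x + c) where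
  contDiff := contDiff_id.add contDiff_const
  exists_inverse := ⟨fun x => x - c, contDiff_id.sub contDiff_const,
    fun x => add_sub_cancel_right x c, fun x => sub_add_cancel x c⟩
  map_bracket f g _ _ x := by
    -- The partial derivatives of `f ∘ Φ` at `x` are those of `f` at `x + c`, so only the
    -- coefficients remain to be compared.
    simp only [bracket, Function.comp_def, fderiv_comp_add_right, h]

end TodaLattice

theorem proposition4 (m n : ℕ) (hn : 1 ≤ n) :
    TodaLattice.IsPoissonIso
      (fun x : TodaLattice.FlaschkaSpace m =>
        ∑ j ∈ Finset.range n, ((n - 1).choose j : ℝ) • TodaLattice.todaTensor m (n - j) x)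
      (fun x : TodaLattice.FlaschkaSpace m => TodaLattice.todaTensor m n x)
      (TodaLattice.shift m) := by
  -- Writing `n = k + 1` removes the truncated `n - 1`.
  obtain ⟨k, rfl⟩ := Nat.exists_eq_add_of_le' hn
  rw [TodaLattice.shift_eq_add]
  refine TodaLattice.isPoissonIso_add_const _ _ _ fun x => ?_
  rw [← congrFun (TodaLattice.shift_eq_add m) x, TodaLattice.todaTensor_shift,
    Nat.add_sub_cancel]
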